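/- Let $n\ge 0$, let $M$ be a smooth $(n+1)$-dimensional manifold with a smooth Lorentzian metric $g$ of signature $(-,+,\dots,+)$ and Levi-Civita connection $\nabla$, and let $f:M\to\mathbb R$ be a spacetime convex function, that is, a smooth function whose Hessian $\nabla_\mu\nabla_\nu f$ has Lorentzian signature $(-,+,\dots,+)$ at every point and for which there is a constant $c>0$ such that $$V^\mu V^\nu\nabla_\mu\nabla_\nu f\ \ge\ c\,g_{\mu\nu}V^\mu V^\nu\qquad\text{for all } V\in TM .$$ Let $\varphi:\Sigma\to M$ be a (smoothly immersed) spacelike hypersurface: $\Sigma$ is a smooth $n$-dimensional manifold, $\varphi$ is smooth, and the induced metric $h=\varphi^*g$ is positive definite. Suppose that $\Sigma$ is totally geodesic (a surface of time symmetry), that is, its second fundamental form with respect to the unit timelike normal vanishes identically, $K_{ij}=0$. Then the restriction $f\circ\varphi$ of $f$ to $\Sigma$ is a uniformly convex function on the Riemannian manifold $(\Sigma,h)$: it is smooth, and there is a constant $c'>0$ such that $$v^iv^jD_iD_j(f\circ\varphi)\ \ge\ c'\,h_{ij}v^iv^j\qquad\text{for all } v\in T\Sigma ,$$ where $D$ is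 the Levi-Civita connection of $h$. In particular $(\Sigma,h)$ admits a convex function. -/

import Mathlib

open scoped Manifold ContDiff

set_option maxSynthPendingDepth 3

noncomputable section

namespace SpacetimeConvex

/-! ## Covariant Hessians in local coordinates

`M` is a manifold modelled on `E`. The tangent space at `x` is, by definition, a copy of `E`, read
through the preferred chart at `x`; tensors at `x` are therefore computed in that chart. -/

section Hessian

variable {E : Type*} [NormedAddCommGroup E] [NormedSpace ℝ E]
  {M : Type*} [TopologicalSpace M] [ChartedSpace E M]

/-- The components `g_{ij}(y)`, as a bilinear form on `E`, of a field of bilinear forms `g` in the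
preferred chart at `x`; here `y : E` runs through the image of the chart. -/
def metricInChart
    (g : ∀ x : M, TangentSpace 𝓘(ℝ, E) x →L[ℝ] TangentSpace 𝓘(ℝ, E) x →L[ℝ] ℝ)
    (x : M) (y : E) : E →L[ℝ] E →L[ℝ] ℝ :=
  ContinuousLinearMap.bilinearComp (E := E) (F := E)
    (g ((extChartAt 𝓘(ℝ, E) x).symm y))
    (mfderiv 𝓘(ℝ, E) 𝓘(ℝ, E) (extChartAt 𝓘(ℝ, E) x).symm y)
    (mfderiv 𝓘(ℝ, E) 𝓘(ℝ, E) (extChartAt 𝓘(ℝ, E) x).symm y)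

/-- Christoffel symbols of the first kind at the point `x`,
`[ij,k] = (1/2) (∂_i g_{jk} + ∂_j g_{ik} - ∂_k g_{ij})`, as a trilinear map. -/
def christoffelFirst
    (g : ∀ x : M, TangentSpace 𝓘(ℝ, E) x →L[ℝ] TangentSpace 𝓘(ℝ, E) x →L[ℝ] ℝ)
    (x : M) : E →L[ℝ] E →L[ℝ] E →L[ℝ] ℝ :=
  let D : E →L[ℝ] E →L[ℝ] E →L[ℝ] ℝ :=
    fderiv ℝ (metricInChart g x) (extChartAt 𝓘(ℝ, E) x x)
  (1 / 2 : ℝ) • (D + D.flip -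
    ((ContinuousLinearMap.flipₗᵢ ℝ E E ℝ).toContinuousLinearEquiv :
      (E →L[ℝ] E →L[ℝ] ℝ) →L[ℝ] (E →L[ℝ] E →L[ℝ] ℝ)).comp D.flip)

theorem christoffelFirst_apply
    (g : ∀ x : M, TangentSpace 𝓘(ℝ, E) x →L[ℝ] TangentSpace 𝓘(ℝ, E) x →L[ℝ] ℝ)
    (x : M) (u v w : E) :
    christoffelFirst g x u v w =
      1 / 2 * (fderiv ℝ (metricInChart g x) (extChartAt 𝓘(ℝ, E) x x) u v w
        + fderiv ℝ (metricInChart g x) (extChartAt 𝓘(ℝ, E) x x) v u w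
        - fderiv ℝ (metricInChart g x) (extChartAt 𝓘(ℝ, E) x x) w u v) := rfl

/-- Christoffel symbols of the second kind at the point `x`, `Γ^k_{ij} = g^{kl} [ij,l]`, as an
`E`-valued bilinear map: those of the Levi-Civita connection of `g`. -/
def christoffel
    (g : ∀ x : M, TangentSpace 𝓘(ℝ, E) x →L[ℝ] TangentSpace 𝓘(ℝ, E) x →L[ℝ] ℝ)
    (x : M) : E →L[ℝ] E →L[ℝ] E :=
  (ContinuousLinearMap.compL ℝ E (E →L[ℝ] ℝ) E
    (metricInChart g x (extChartAt 𝓘(ℝ, E) x x)).inverse).comp (christoffelFirst g x)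

theorem christoffel_apply
    (g : ∀ x : M, TangentSpace 𝓘(ℝ, E) x →L[ℝ] TangentSpace 𝓘(ℝ, E) x →L[ℝ] ℝ)
    (x : M) (u v : E) :
    christoffel g x u v =
      (metricInChart g x (extChartAt 𝓘(ℝ, E) x x)).inverse (christoffelFirst g x u v) := rfl

/-- The Hessian `∇_i ∇_j f = ∂_i ∂_j f - Γ^k_{ij} ∂_k f` of a function `f` at the point `x`, for
the Levi-Civita connection `∇` of `g`. -/
def hessian
    (g : ∀ x : M, TangentSpace 𝓘(ℝ, E) x →L[ℝ] TangentSpace 𝓘(ℝ, E) x →L[ℝ] ℝ)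
    (f : M → ℝ) (x : M) :
    TangentSpace 𝓘(ℝ, E) x →L[ℝ] TangentSpace 𝓘(ℝ, E) x →L[ℝ] ℝ :=
  let F : E → ℝ := f ∘ (extChartAt 𝓘(ℝ, E) x).symm
  let p : E := extChartAt 𝓘(ℝ, E) x x
  (fderiv ℝ (fderiv ℝ F) p -
    (ContinuousLinearMap.compL ℝ E E ℝ (fderiv ℝ F p)).comp (christoffel g x) :
    E →L[ℝ] E →L[ℝ] ℝ)

theorem hessian_apply
    (g : ∀ x : M, TangentSpace 𝓘(ℝ, E) x →L[ℝ] TangentSpace 𝓘(ℝ, E) x →L[ℝ] ℝ)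
    (f : M → ℝ) (x : M) (u v : E) :
    hessian g f x u v =
      fderiv ℝ (fderiv ℝ (f ∘ (extChartAt 𝓘(ℝ, E) x).symm)) (extChartAt 𝓘(ℝ, E) x x) u v
        - fderiv ℝ (f ∘ (extChartAt 𝓘(ℝ, E) x).symm) (extChartAt 𝓘(ℝ, E) x x)
          (christoffel g x u v) := rfl

end Hessian

/-! ## Spacetimes -/

/-- A symmetric bilinear form on an `(n + 1)`-dimensional real vector space has Lorentzian
signature `(-, +, …, +)`: in some basis its matrix is `diag (-1, 1, …, 1)`. -/
def IsLorentzian (n : ℕ) {V : Type*} [AddCommGroup V] [Module ℝ V] [TopologicalSpace V]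
    (B : V →L[ℝ] V →L[ℝ] ℝ) : Prop :=
  ∃ b : Module.Basis (Fin (n + 1)) ℝ V, ∀ i j : Fin (n + 1),
    B (b i) (b j) = if i = j then (if i = 0 then -1 else 1) else 0

/-- A smooth Lorentzian metric on an `(n + 1)`-dimensional manifold `M`. -/
structure LorentzianMetric (n : ℕ) (M : Type*) [TopologicalSpace M]
    [ChartedSpace (EuclideanSpace ℝ (Fin (n + 1))) M] [IsManifold (𝓡 (n + 1)) ∞ M] where
  /-- The bilinear form on each tangent space. -/
  inner (x : M) : TangentSpace (𝓡 (n + 1)) x →L[ℝ] TangentSpace (𝓡 (n + 1)) x →L[ℝ] ℝ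
  isLorentzian (x : M) : IsLorentzian n (inner x)
  contMDiff : ContMDiff (𝓡 (n + 1))
    ((𝓡 (n + 1)).prod 𝓘(ℝ, EuclideanSpace ℝ (Fin (n + 1)) →L[ℝ]
      EuclideanSpace ℝ (Fin (n + 1)) →L[ℝ] ℝ)) ∞
    (fun x ↦ Bundle.TotalSpace.mk' (EuclideanSpace ℝ (Fin (n + 1)) →L[ℝ]
      EuclideanSpace ℝ (Fin (n + 1)) →L[ℝ] ℝ) x (inner x))

section Spacetime

variable {n : ℕ} {M : Type*} [TopologicalSpace M]
  [ChartedSpace (EuclideanSpace ℝ (Fin (n + 1))) M] [IsManifold (𝓡 (n + 1)) ∞ M]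

/-- A spacetime convex function on `(M, g)`: a smooth function whose Hessian has Lorentzian
signature at each point and satisfies `∇∇f (V, V) ≥ c g (V, V)` for all tangent vectors `V`, with a
constant `c > 0`. -/
structure IsSpacetimeConvex (g : LorentzianMetric n M) (f : M → ℝ) : Prop where
  contMDiff : ContMDiff (𝓡 (n + 1)) 𝓘(ℝ, ℝ) ∞ f
  isLorentzian : ∀ x : M, IsLorentzian n (hessian g.inner f x)
  bound : ∃ c : ℝ, 0 < c ∧ ∀ (x : M) (V : TangentSpace (𝓡 (n + 1)) x),
    c * g.inner x V V ≤ hessian g.inner f x V V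

end Spacetime

/-! ## Uniformly convex functions on Riemannian manifolds -/

/-- A smooth Riemannian metric on an `n`-dimensional manifold. -/
abbrev RiemMetric (n : ℕ) (S : Type*) [TopologicalSpace S]
    [ChartedSpace (EuclideanSpace ℝ (Fin n)) S] [IsManifold (𝓡 n) ∞ S] :=
  Bundle.ContMDiffRiemannianMetric (𝓡 n) ∞ (EuclideanSpace ℝ (Fin n))
    (fun x : S ↦ TangentSpace (𝓡 n) x)

/-- A uniformly convex function on the Riemannian manifold `(S, h)`: a smooth function with
`D_i D_j f ≥ c h_{ij}` for a constant `c > 0`, where `D` is the Levi-Civita connection of `h`. -/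
structure IsUniformlyConvex {n : ℕ} {S : Type*} [TopologicalSpace S]
    [ChartedSpace (EuclideanSpace ℝ (Fin n)) S] [IsManifold (𝓡 n) ∞ S]
    (h : RiemMetric n S) (f : S → ℝ) : Prop where
  contMDiff : ContMDiff (𝓡 n) 𝓘(ℝ, ℝ) ∞ f
  bound : ∃ c : ℝ, 0 < c ∧ ∀ (q : S) (v : TangentSpace (𝓡 n) q),
    c * h.inner q v v ≤ hessian h.inner f q v v

/-! ## Spacelike hypersurfaces -/

section Hypersurface

variable {n : ℕ} {M : Type*} [TopologicalSpace M]
  [ChartedSpace (EuclideanSpace ℝ (Fin (n + 1))) M] [IsManifold (𝓡 (n + 1)) ∞ M]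
  {S : Type*} [TopologicalSpace S]
  [ChartedSpace (EuclideanSpace ℝ (Fin n)) S] [IsManifold (𝓡 n) ∞ S]

/-- `φ : S → M` is a spacelike hypersurface: `S` has codimension one, `φ` is smooth, and the
pullback of `g` is positive definite. In particular `φ` is an immersion. -/
structure IsSpacelikeHypersurface (g : LorentzianMetric n M) (φ : S → M) : Prop where
  contMDiff : ContMDiff (𝓡 n) (𝓡 (n + 1)) ∞ φ
  pos : ∀ (q : S) (v : TangentSpace (𝓡 n) q), v ≠ 0 →
    0 < g.inner (φ q) (mfderiv (𝓡 n) (𝓡 (n + 1)) φ q v) (mfderiv (𝓡 n) (𝓡 (n + 1)) φ q v)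

/-- The pullback `φ^* g` as a field of bilinear forms on `S`. -/
def pullbackForm (g : LorentzianMetric n M) (φ : S → M) (q : S) :
    TangentSpace (𝓡 n) q →L[ℝ] TangentSpace (𝓡 n) q →L[ℝ] ℝ :=
  ContinuousLinearMap.bilinearComp (E := EuclideanSpace ℝ (Fin (n + 1)))
    (F := EuclideanSpace ℝ (Fin (n + 1))) (E' := EuclideanSpace ℝ (Fin n))
    (F' := EuclideanSpace ℝ (Fin n)) (g.inner (φ q))
    (mfderiv (𝓡 n) (𝓡 (n + 1)) φ q) (mfderiv (𝓡 n) (𝓡 (n + 1)) φ q)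

theorem LorentzianMetric.symm (g : LorentzianMetric n M) (x : M)
    (u v : TangentSpace (𝓡 (n + 1)) x) : g.inner x u v = g.inner x v u := by
  obtain ⟨b, hb⟩ := g.isLorentzian x
  have key : LinearMap.toMatrix₂ b b
      ((ContinuousLinearMap.coeLM ℝ).comp (g.inner x).toLinearMap) = 
      (LinearMap.toMatrix₂ b b
      ((ContinuousLinearMap.coeLM ℝ).comp (g.inner x).toLinearMap).flip) := by
    ext i j
    simp only [LinearMap.toMatrix₂_apply]
    change g.inner x (b i) (b j) = g.inner x (b j) (b i)
    rw [hb, hb]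
    by_cases h : i = j
    · subst h; rfl
    · rw [if_neg h, if_neg (Ne.symm h)]
  have := (LinearMap.toMatrix₂ b b).injective key
  exact congrArg (fun B ↦ B u v) this

theorem isVonNBounded_of_pos {E : Type*} [NormedAddCommGroup E] [NormedSpace ℝ E]
    [FiniteDimensional ℝ E] (B : E →L[ℝ] E →L[ℝ] ℝ) (hB : ∀ v, v ≠ 0 → 0 < B v v) :
    Bornology.IsVonNBounded ℝ {v : E | B v v < 1} := by
  rw [NormedSpace.isVonNBounded_iff]
  have hc : Continuous fun v : E ↦ B v v := by fun_prop
  rcases (Metric.sphere (0 : E) 1).eq_empty_or_nonempty with h0 | hne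
  · refine (Bornology.isBounded_singleton (x := (0 : E))).subset fun v _ ↦ ?_
    by_contra hv
    have : ‖v‖⁻¹ • v ∈ Metric.sphere (0 : E) 1 := by
      have : ‖v‖ ≠ 0 := norm_ne_zero_iff.2 hv
      simp [norm_smul, this]
    simp [h0] at this
  · obtain ⟨w, hw, hmin⟩ := (isCompact_sphere (0 : E) 1).exists_isMinOn hne hc.continuousOn
    have hw0 : w ≠ 0 := by
      rintro rfl; simp at hw
    have hm := hB w hw0
    refine (Metric.isBounded_closedBall (x := (0 : E)) (r := 1 + (B w w)⁻¹)).subset fun v hv ↦ ?_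
    rw [mem_closedBall_zero_iff]
    by_cases h1 : ‖v‖ ≤ 1
    · have := inv_pos.2 hm; linarith
    · push Not at h1
      have hv0 : ‖v‖ ≠ 0 := by linarith
      have hs : ‖v‖⁻¹ • v ∈ Metric.sphere (0 : E) 1 := by simp [norm_smul, hv0]
      have h2 : B w w ≤ B (‖v‖⁻¹ • v) (‖v‖⁻¹ • v) := hmin hs
      have h3 : B v v = ‖v‖ ^ 2 * B (‖v‖⁻¹ • v) (‖v‖⁻¹ • v) := by
        simp; field_simp
      have h4 : B v v < 1 := hv
      have h5 : ‖v‖ * B w w ≤ 1 := by nlinarith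
      have : ‖v‖ ≤ (B w w)⁻¹ := by rw [← one_div, le_div_iff₀ hm]; exact h5
      linarith

theorem contMDiff_pullbackForm (g : LorentzianMetric n M) {φ : S → M}
    (hφ : ContMDiff (𝓡 n) (𝓡 (n + 1)) ∞ φ) :
    ContMDiff (𝓡 n) ((𝓡 n).prod 𝓘(ℝ, EuclideanSpace ℝ (Fin n) →L[ℝ]
      EuclideanSpace ℝ (Fin n) →L[ℝ] ℝ)) ∞
      (fun q ↦ Bundle.TotalSpace.mk' (EuclideanSpace ℝ (Fin n) →L[ℝ]
        EuclideanSpace ℝ (Fin n) →L[ℝ] ℝ) q (pullbackForm g φ q)) := by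
  intro q₀
  rw [contMDiffAt_hom_bundle]
  refine ⟨contMDiffAt_id, ?_⟩
  have hA := (hφ q₀).mfderiv_const (m := ∞) (by simp)
  have hG := ((contMDiffAt_hom_bundle _).1 (g.contMDiff (φ q₀))).2.comp q₀ (hφ q₀)
  have hcomp := (hA.clm_precomp (F₃ := ℝ)).clm_comp (hG.clm_comp hA)
  refine hcomp.congr_of_eventuallyEq ?_
  have h1 : ∀ᶠ q in nhds q₀, q ∈ (chartAt (EuclideanSpace ℝ (Fin n)) q₀).source :=
    (chartAt _ q₀).open_source.mem_nhds (mem_chart_source _ q₀)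
  have h2 : ∀ᶠ q in nhds q₀,
      φ q ∈ (chartAt (EuclideanSpace ℝ (Fin (n + 1))) (φ q₀)).source :=
    (hφ q₀).continuousAt.eventually
      ((chartAt _ (φ q₀)).open_source.mem_nhds (mem_chart_source _ (φ q₀)))
  filter_upwards [h1, h2] with q hq hq'
  have hA' (v : EuclideanSpace ℝ (Fin n)) :
      (trivializationAt (EuclideanSpace ℝ (Fin (n + 1)))
        (TangentSpace (𝓡 (n + 1)) : M → Type _) (φ q₀)).symm (φ q)
        (inTangentCoordinates (𝓡 n) (𝓡 (n + 1)) id φ (mfderiv (𝓡 n) (𝓡 (n + 1)) φ) q₀ q v) =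
      mfderiv (𝓡 n) (𝓡 (n + 1)) φ q ((trivializationAt (EuclideanSpace ℝ (Fin n))
        (TangentSpace (𝓡 n) : S → Type _) q₀).symm q v) := by
    let e := trivializationAt (EuclideanSpace ℝ (Fin (n + 1)))
      (TangentSpace (𝓡 (n + 1)) : M → Type _) (φ q₀)
    let e' := trivializationAt (EuclideanSpace ℝ (Fin n)) (TangentSpace (𝓡 n) : S → Type _) q₀
    have H1 := e.symmL_continuousLinearMapAt (R := ℝ) hq'
      (mfderiv (𝓡 n) (𝓡 (n + 1)) φ q (e'.symmL ℝ q v))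
    have H2 := e.symmL_apply (R := ℝ) hq' (e.continuousLinearMapAt ℝ (φ q)
      (mfderiv (𝓡 n) (𝓡 (n + 1)) φ q (e'.symmL ℝ q v)))
    have H3 := congrArg (mfderiv (𝓡 n) (𝓡 (n + 1)) φ q) (e'.symmL_apply (R := ℝ) hq v)
    exact H2.symm.trans (H1.trans H3)
  ext u v
  simp only [ContinuousLinearMap.comp_apply, ContinuousLinearMap.precomp_apply,
    Function.comp_apply]
  rw [inCoordinates_apply_eq₂ hq hq (Set.mem_univ _),
    inCoordinates_apply_eq₂ hq' hq' (Set.mem_univ _), hA', hA']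
  rfl

/-- The Riemannian metric `h = φ^* g` induced on a spacelike hypersurface. -/
def inducedMetric (g : LorentzianMetric n M) (φ : S → M) (hφ : IsSpacelikeHypersurface g φ) :
    RiemMetric n S where
  inner := pullbackForm g φ
  symm q _ _ := g.symm (φ q) _ _
  pos := hφ.pos
  isVonNBounded q := isVonNBounded_of_pos (E := EuclideanSpace ℝ (Fin n)) _ (hφ.pos q)
  contMDiff := contMDiff_pullbackForm g hφ.contMDiff

/-- The covariant derivative `∇_i ∂_j φ` of the differential of `φ` along `φ`, for the
Levi-Civita connection of `g`: in coordinates `∂_i ∂_j φ^μ + Γ^μ_{αβ} ∂_i φ^α ∂_j φ^β`. -/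
def covDerivDifferential (g : LorentzianMetric n M) (φ : S → M) (q : S)
    (u v : TangentSpace (𝓡 n) q) : TangentSpace (𝓡 (n + 1)) (φ q) :=
  let Φ : EuclideanSpace ℝ (Fin n) → EuclideanSpace ℝ (Fin (n + 1)) :=
    extChartAt (𝓡 (n + 1)) (φ q) ∘ φ ∘ (extChartAt (𝓡 n) q).symm
  let p : EuclideanSpace ℝ (Fin n) := extChartAt (𝓡 n) q q
  (fderiv ℝ (fderiv ℝ Φ) p u v + christoffel g.inner (φ q) (fderiv ℝ Φ p u) (fderiv ℝ Φ p v) :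
    EuclideanSpace ℝ (Fin (n + 1)))

/-- `ν` is a unit normal of the hypersurface at `q`; being normal to a spacelike hyperplane, it is
timelike. -/
def IsUnitNormal (g : LorentzianMetric n M) (φ : S → M) (q : S)
    (ν : TangentSpace (𝓡 (n + 1)) (φ q)) : Prop :=
  g.inner (φ q) ν ν = -1 ∧
    ∀ w : TangentSpace (𝓡 n) q, g.inner (φ q) ν (mfderiv (𝓡 n) (𝓡 (n + 1)) φ q w) = 0

/-- The second fundamental form `K_{ij} = g (∇_i ν, ∂_j φ) = - g (ν, ∇_i ∂_j φ)` with respect to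
the unit normal `ν`. -/
def secondFundamentalForm (g : LorentzianMetric n M) (φ : S → M) (q : S)
    (ν : TangentSpace (𝓡 (n + 1)) (φ q)) (u v : TangentSpace (𝓡 n) q) : ℝ :=
  -g.inner (φ q) ν (covDerivDifferential g φ q u v)

/-- The hypersurface is totally geodesic (a surface of time symmetry): `K_{ij} = 0` everywhere. -/
def IsTotallyGeodesic (g : LorentzianMetric n M) (φ : S → M) : Prop :=
  ∀ (q : S) (ν : TangentSpace (𝓡 (n + 1)) (φ q)), IsUnitNormal g φ q ν →
    ∀ u v : TangentSpace (𝓡 n) q, secondFundamentalForm g φ q ν u v = 0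

end Hypersurface

end SpacetimeConvex

end

/-!
On a totally geodesic hypersurface the Hessian of the restriction `f ∘ φ` for the induced metric `h`
is the restriction of the spacetime Hessian of `f` (`hessian_pullbackForm_comp`). The bound
`∇∇f ≥ c g`, applied to the vectors `V = dφ (v)`, then reads `DD(f ∘ φ) ≥ c h`, with the same `c`.

For the equality of Hessians, work at `q` in the preferred charts at `q` and `φ q`, and let `Φ` be
the expression of `φ` in them. The chain rule gives
`DD(f ∘ φ) (u, v) = ∇∇f (Φ'u, Φ'v) + df (X)`, where `X = ∇_u ∂_v φ - Φ' (Γ_h (u, v))` and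
`∇_u ∂_v φ = Φ''(u, v) + Γ_g (Φ'u, Φ'v)`. Differentiating `h = φ^* g`, in coordinates, gives
`[uv,w]_h = [Φ'u Φ'v, Φ'w]_g + g (Φ''(u, v), Φ'w)` (`christoffelFirst_pullbackForm`), that is,
`X` is normal to the hypersurface. A nonzero normal vector is timelike
(`IsLorentzian.neg_of_orthogonal`), so if `X ≠ 0` then `ν = X / √(-g (X, X))` is a unit normal, and
`0 = K (u, v) = -g (ν, ∇_u ∂_v φ) = -g (ν, X) ≠ 0`. Hence `X = 0`
(`IsTotallyGeodesic.covDerivDifferential_eq`).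
-/

namespace SpacetimeConvex

/-! ### First and second derivatives of pulled-back tensors in vector spaces -/

section Calculus

variable {E F : Type*} [NormedAddCommGroup E] [NormedSpace ℝ E]
  [NormedAddCommGroup F] [NormedSpace ℝ F]

/-- Derivative of the pullback `H = Φ^* G` of a field of bilinear forms, where `H` agrees with the
pullback only near `p`. -/
theorem fderiv_bilinearComp_fderiv_apply {Φ : E → F} {G : F → F →L[ℝ] F →L[ℝ] ℝ}
    {H : E → E →L[ℝ] E →L[ℝ] ℝ} {p : E} (hΦ : ContDiffAt ℝ 2 Φ p)
    (hG : DifferentiableAt ℝ G (Φ p))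
    (hH : ∀ᶠ y in nhds p, ∀ u v, H y u v = G (Φ y) (fderiv ℝ Φ y u) (fderiv ℝ Φ y v))
    (hHd : DifferentiableAt ℝ H p) (w u v : E) :
    fderiv ℝ H p w u v =
      fderiv ℝ G (Φ p) (fderiv ℝ Φ p w) (fderiv ℝ Φ p u) (fderiv ℝ Φ p v)
        + G (Φ p) (fderiv ℝ (fderiv ℝ Φ) p w u) (fderiv ℝ Φ p v)
        + G (Φ p) (fderiv ℝ Φ p u) (fderiv ℝ (fderiv ℝ Φ) p w v) := by
  have hΦ1 : HasFDerivAt Φ (fderiv ℝ Φ p) p :=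
    (hΦ.differentiableAt (by norm_num)).hasFDerivAt
  have hΦ2 : HasFDerivAt (fderiv ℝ Φ) (fderiv ℝ (fderiv ℝ Φ) p) p :=
    ((hΦ.fderiv_right (m := 1) (by norm_num)).differentiableAt (by norm_num)).hasFDerivAt
  have hu := hΦ2.clm_apply (hasFDerivAt_const u p)
  have hv := hΦ2.clm_apply (hasFDerivAt_const v p)
  have hR := ((hG.hasFDerivAt.comp p hΦ1).clm_apply hu).clm_apply hv
  have hL := (hHd.hasFDerivAt.clm_apply (hasFDerivAt_const u p)).clm_apply
    (hasFDerivAt_const v p)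
  have := congrArg (fun L : E →L[ℝ] ℝ ↦ L w)
    (hL.unique (hR.congr_of_eventuallyEq (hH.mono fun y hy ↦ hy u v)))
  simp at this
  rw [this]
  ring

theorem fderiv_fderiv_comp_apply {Φ : E → F} {f : F → ℝ} {p : E} (hΦ : ContDiffAt ℝ 2 Φ p)
    (hf : ContDiffAt ℝ 2 f (Φ p)) (u v : E) :
    fderiv ℝ (fderiv ℝ (f ∘ Φ)) p u v =
      fderiv ℝ (fderiv ℝ f) (Φ p) (fderiv ℝ Φ p u) (fderiv ℝ Φ p v)
        + fderiv ℝ f (Φ p) (fderiv ℝ (fderiv ℝ Φ) p u v) := by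
  have hΦ1 : HasFDerivAt Φ (fderiv ℝ Φ p) p :=
    (hΦ.differentiableAt (by norm_num)).hasFDerivAt
  have hΦ2 : HasFDerivAt (fderiv ℝ Φ) (fderiv ℝ (fderiv ℝ Φ) p) p :=
    ((hΦ.fderiv_right (m := 1) (by norm_num)).differentiableAt (by norm_num)).hasFDerivAt
  have hf2 : HasFDerivAt (fderiv ℝ f) (fderiv ℝ (fderiv ℝ f) (Φ p)) (Φ p) :=
    ((hf.fderiv_right (m := 1) (by norm_num)).differentiableAt (by norm_num)).hasFDerivAt
  have hfd : ∀ᶠ z in nhds (Φ p), DifferentiableAt ℝ f z :=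
    (hf.eventually (by simp)).mono fun z hz ↦ hz.differentiableAt (by norm_num)
  have hΦd : ∀ᶠ y in nhds p, DifferentiableAt ℝ Φ y :=
    (hΦ.eventually (by simp)).mono fun y hy ↦ hy.differentiableAt (by norm_num)
  have hev : fderiv ℝ (f ∘ Φ) =ᶠ[nhds p] fun y ↦ (fderiv ℝ f (Φ y)).comp (fderiv ℝ Φ y) := by
    filter_upwards [hΦd, hΦ.continuousAt.eventually hfd] with y hy hy'
    exact fderiv_comp y hy' hy
  rw [hev.fderiv_eq, (HasFDerivAt.clm_comp (c := fun y ↦ fderiv ℝ f (Φ y))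
    (hf2.comp p hΦ1) hΦ2).fderiv]
  simp [add_comm]

end Calculus

/-! ### The components of a metric in the preferred chart -/

section Chart

variable {E : Type*} [NormedAddCommGroup E] [NormedSpace ℝ E]
  {M : Type*} [TopologicalSpace M] [ChartedSpace E M]

/-- The tangent space at `x` is read through the chart at `x`, so that chart has derivative the
identity at its centre. -/
theorem mfderiv_extChartAt_symm_self [IsManifold 𝓘(ℝ, E) 1 M] (x : M) :
    mfderiv 𝓘(ℝ, E) 𝓘(ℝ, E) (extChartAt 𝓘(ℝ, E) x).symm (extChartAt 𝓘(ℝ, E) x x) =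
      ContinuousLinearMap.id ℝ E := by
  have := mfderivWithin_range_extChartAt_symm (I := 𝓘(ℝ, E)) (x := x)
  rw [modelWithCornersSelf_coe, Set.range_id, mfderivWithin_univ] at this
  exact this

theorem metricInChart_self [IsManifold 𝓘(ℝ, E) 1 M]
    (g : ∀ x : M, TangentSpace 𝓘(ℝ, E) x →L[ℝ] TangentSpace 𝓘(ℝ, E) x →L[ℝ] ℝ) (x : M)
    (u v : E) :
    metricInChart g x (extChartAt 𝓘(ℝ, E) x x) u v = g x u v := by
  have h := mfderiv_extChartAt_symm_self (E := E) x
  -- the base point of the left-hand side is only propositionally equal to `x`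
  have key : ∀ z : M, z = x → ∀ A : E →L[ℝ] E, A = ContinuousLinearMap.id ℝ E →
      (g z : E →L[ℝ] E →L[ℝ] ℝ) (A u) (A v) = (g x : E →L[ℝ] E →L[ℝ] ℝ) u v := by
    rintro z rfl A rfl; rfl
  exact key _ (extChartAt_to_inv x) _ h

theorem differentiableAt_metricInChart [IsManifold 𝓘(ℝ, E) ∞ M]
    {g : ∀ x : M, TangentSpace 𝓘(ℝ, E) x →L[ℝ] TangentSpace 𝓘(ℝ, E) x →L[ℝ] ℝ}
    (hg : ContMDiff 𝓘(ℝ, E) (𝓘(ℝ, E).prod 𝓘(ℝ, E →L[ℝ] E →L[ℝ] ℝ)) ∞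
      (fun x ↦ Bundle.TotalSpace.mk' (E →L[ℝ] E →L[ℝ] ℝ) x (g x))) (x : M) :
    DifferentiableAt ℝ (metricInChart g x) (extChartAt 𝓘(ℝ, E) x x) := by
  have : IsManifold 𝓘(ℝ, E) 1 M := IsManifold.of_le (n := ∞) (by simp)
  have h1 := ((contMDiffAt_hom_bundle _).1 (hg x)).2
  have hs : ContMDiffAt 𝓘(ℝ, E) 𝓘(ℝ, E) ∞ (extChartAt 𝓘(ℝ, E) x).symm
      (extChartAt 𝓘(ℝ, E) x x) :=
    (contMDiffOn_extChartAt_symm x).contMDiffAt (extChartAt_target_mem_nhds x)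
  have h2 := (h1.comp_of_eq hs (extChartAt_to_inv x)).contDiffAt.differentiableAt (by simp)
  refine h2.congr_of_eventuallyEq ?_
  filter_upwards [extChartAt_target_mem_nhds (I := 𝓘(ℝ, E)) x] with y hy
  have hy' : (extChartAt 𝓘(ℝ, E) x).symm y ∈ (chartAt E x).source := by
    simpa using (extChartAt 𝓘(ℝ, E) x).map_target hy
  have h3 := TangentBundle.symmL_trivializationAt (I := 𝓘(ℝ, E)) hy'
  rw [modelWithCornersSelf_coe, Set.range_id, mfderivWithin_univ,
    (extChartAt 𝓘(ℝ, E) x).right_inv hy] at h3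
  -- the trivialization of the tangent bundle is the derivative of the chart
  have h4 (v : E) : (trivializationAt E (TangentSpace 𝓘(ℝ, E) : M → Type _) x).symm
      ((extChartAt 𝓘(ℝ, E) x).symm y) v =
      mfderiv 𝓘(ℝ, E) 𝓘(ℝ, E) (extChartAt 𝓘(ℝ, E) x).symm y v := by
    rw [← h3]
    exact (Bundle.Trivialization.symmL_apply (R := ℝ) _ hy' v).symm
  ext u v
  simp only [Function.comp_apply]
  rw [inCoordinates_apply_eq₂ hy' hy' (Set.mem_univ _), h4, h4]
  exact (LinearMap.congr_fun (Bundle.Trivial.linearMapAt_trivialization ℝ M ℝ _) _).symm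

end Chart

/-! ### Lorentzian bilinear forms -/

section Lorentz

theorem IsLorentzian.exists_neg {n : ℕ} {V : Type*} [AddCommGroup V] [Module ℝ V]
    [TopologicalSpace V] {B : V →L[ℝ] V →L[ℝ] ℝ} (hB : IsLorentzian n B) :
    ∃ w : V, B w w < 0 := by
  obtain ⟨b, hb⟩ := hB
  exact ⟨b 0, by simp [hb]⟩

/-- Lorentzian forms are nondegenerate. -/
theorem IsLorentzian.eq_zero_of_forall {n : ℕ} {V : Type*} [AddCommGroup V] [Module ℝ V]
    [TopologicalSpace V] {B : V →L[ℝ] V →L[ℝ] ℝ} (hB : IsLorentzian n B) {x : V}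
    (hx : ∀ y, B x y = 0) : x = 0 := by
  obtain ⟨b, hb⟩ := hB
  have hc : ∀ j, b.repr x j = 0 := by
    intro j
    have h := hx (b j)
    rw [← b.sum_repr x] at h
    simp only [map_sum, map_smul, sum_apply, smul_apply, hb, smul_eq_mul, mul_ite, mul_zero,
      Finset.sum_ite_eq', Finset.mem_univ, if_true] at h
    split_ifs at h <;> linarith
  rw [← b.sum_repr x]
  simp [hc]

/-- A nonzero vector orthogonal to a spacelike hyperplane is timelike: otherwise the form would be
nonnegative on the span of the hyperplane and the vector, which is the whole space. -/
theorem IsLorentzian.neg_of_orthogonal {n : ℕ} {V W : Type*} [AddCommGroup V] [Module ℝ V]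
    [TopologicalSpace V] [AddCommGroup W] [Module ℝ W] {B : V →L[ℝ] V →L[ℝ] ℝ}
    (hB : IsLorentzian n B) (hsymm : ∀ x y, B x y = B y x) (A : W →ₗ[ℝ] V)
    (hW : Module.finrank ℝ W = n) (hA : ∀ w, w ≠ 0 → 0 < B (A w) (A w)) {x : V} (hx : x ≠ 0)
    (hxA : ∀ w, B x (A w) = 0) : B x x < 0 := by
  by_contra! hneg
  obtain ⟨b, hb⟩ := id hB
  have : FiniteDimensional ℝ V := Module.Finite.of_basis b
  have hV : Module.finrank ℝ V = n + 1 := by simp [Module.finrank_eq_card_basis b]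
  have hq (w : W) (t : ℝ) : B (A w + t • x) (A w + t • x) = B (A w) (A w) + t ^ 2 * B x x := by
    simp [hxA, hsymm (A w) x]; ring
  have hnn (w : W) : 0 ≤ B (A w) (A w) := by
    rcases eq_or_ne w 0 with rfl | h
    · simp
    · exact (hA w h).le
  let L : W × ℝ →ₗ[ℝ] V := A.coprod (LinearMap.toSpanSingleton ℝ V x)
  have hL (z : W × ℝ) : L z = A z.1 + z.2 • x := by simp [L]
  have hinj : Function.Injective L := by
    rw [injective_iff_map_eq_zero]
    rintro ⟨w, t⟩ h
    rw [hL] at h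
    have hw : w = 0 := by
      by_contra hw
      have := hq w t
      simp only [h, map_zero] at this
      nlinarith [hA w hw, mul_nonneg (sq_nonneg t) hneg]
    subst hw
    have : t = 0 := by simpa [hx] using h
    simp [this]
  have : FiniteDimensional ℝ (W × ℝ) := Module.Finite.of_injective L hinj
  have : FiniteDimensional ℝ W :=
    Module.Finite.of_injective (LinearMap.inl ℝ W ℝ) LinearMap.inl_injective
  have hsurj : Function.Surjective L := by
    refine (LinearMap.injective_iff_surjective_of_finrank_eq_finrank ?_).1 hinj
    rw [Module.finrank_prod, hW, hV]; simp
  obtain ⟨y, hy⟩ := hB.exists_neg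
  obtain ⟨⟨w, t⟩, rfl⟩ := hsurj y
  rw [hL, hq] at hy
  nlinarith [hnn w, mul_nonneg (sq_nonneg t) hneg]

theorem inverse_apply_of_nondegenerate {E : Type*} [NormedAddCommGroup E] [NormedSpace ℝ E]
    [FiniteDimensional ℝ E] (B : E →L[ℝ] E →L[ℝ] ℝ) (hB : ∀ x, (∀ y, B x y = 0) → x = 0)
    (l : E →L[ℝ] ℝ) : B (B.inverse l) = l := by
  have hinj : Function.Injective B := by
    rw [injective_iff_map_eq_zero]
    exact fun x hx ↦ hB x fun y ↦ by rw [hx]; rfl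
  have hdim : Module.finrank ℝ E = Module.finrank ℝ (E →L[ℝ] ℝ) := by
    rw [← (LinearMap.toContinuousLinearMap : (E →ₗ[ℝ] ℝ) ≃ₗ[ℝ] E →L[ℝ] ℝ).finrank_eq]
    exact (Subspace.dual_finrank_eq (K := ℝ) (V := E)).symm
  let e := (LinearEquiv.ofInjectiveOfFinrankEq (B : E →ₗ[ℝ] E →L[ℝ] ℝ) hinj
    hdim).toContinuousLinearEquiv
  have he : (e : E →L[ℝ] E →L[ℝ] ℝ) = B := by ext; rfl
  rw [← he, ContinuousLinearMap.inverse_equiv]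
  simp

end Lorentz

/-! ### Maps between manifolds in the preferred charts -/

section LocalExpression

variable {E : Type*} [NormedAddCommGroup E] [NormedSpace ℝ E]
  {F : Type*} [NormedAddCommGroup F] [NormedSpace ℝ F]
  {M : Type*} [TopologicalSpace M] [ChartedSpace F M]
  {S : Type*} [TopologicalSpace S] [ChartedSpace E S]

variable (E F) in
/-- The expression of a map `φ : S → M` in the preferred charts at `q` and `φ q`. -/
noncomputable def localExpression (φ : S → M) (q : S) : E → F :=
  extChartAt 𝓘(ℝ, F) (φ q) ∘ φ ∘ (extChartAt 𝓘(ℝ, E) q).symm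

theorem localExpression_self (φ : S → M) (q : S) :
    localExpression E F φ q (extChartAt 𝓘(ℝ, E) q q) = extChartAt 𝓘(ℝ, F) (φ q) (φ q) := by
  simp [localExpression]

theorem contDiffAt_localExpression {φ : S → M} {q : S} {k : WithTop ℕ∞}
    (hφ : ContMDiffAt 𝓘(ℝ, E) 𝓘(ℝ, F) k φ q) :
    ContDiffAt ℝ k (localExpression E F φ q) (extChartAt 𝓘(ℝ, E) q q) := by
  have := (contMDiffAt_iff.1 hφ).2
  rwa [modelWithCornersSelf_coe, Set.range_id, contDiffWithinAt_univ] at this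

theorem mfderiv_eq_fderiv_localExpression {φ : S → M} {q : S}
    (hφ : MDifferentiableAt 𝓘(ℝ, E) 𝓘(ℝ, F) φ q) (v : E) :
    mfderiv 𝓘(ℝ, E) 𝓘(ℝ, F) φ q v =
      fderiv ℝ (localExpression E F φ q) (extChartAt 𝓘(ℝ, E) q q) v := by
  rw [hφ.mfderiv, modelWithCornersSelf_coe, Set.range_id, fderivWithin_univ]
  rfl

theorem eventually_mem_target_and_mem_source {φ : S → M} {q : S} (hφ : ContinuousAt φ q) :
    ∀ᶠ y in nhds (extChartAt 𝓘(ℝ, E) q q), y ∈ (extChartAt 𝓘(ℝ, E) q).target ∧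
      φ ((extChartAt 𝓘(ℝ, E) q).symm y) ∈ (extChartAt 𝓘(ℝ, F) (φ q)).source := by
  refine Filter.Eventually.and (extChartAt_target_mem_nhds q) ?_
  have h : ContinuousAt (φ ∘ (extChartAt 𝓘(ℝ, E) q).symm) (extChartAt 𝓘(ℝ, E) q q) :=
    hφ.comp_of_eq (continuousAt_extChartAt_symm q) (extChartAt_to_inv q)
  refine h.eventually ?_
  simp only [Function.comp_apply, extChartAt_to_inv]
  exact extChartAt_source_mem_nhds (φ q)

theorem comp_localExpression_eventuallyEq {X : Type*} {φ : S → M} {q : S}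
    (hφ : ContinuousAt φ q) (f : M → X) :
    (f ∘ φ) ∘ (extChartAt 𝓘(ℝ, E) q).symm =ᶠ[nhds (extChartAt 𝓘(ℝ, E) q q)]
      (f ∘ (extChartAt 𝓘(ℝ, F) (φ q)).symm) ∘ localExpression E F φ q := by
  filter_upwards [eventually_mem_target_and_mem_source (E := E) (F := F) hφ] with y hy
  exact congrArg f ((extChartAt 𝓘(ℝ, F) (φ q)).left_inv hy.2).symm

/-- The chain rule for both sides of `φ ∘ s = t ∘ Φ`, where `s` and `t` are the inverses of the
charts at `q` and `φ q`, and `Φ` is the local expression of `φ`. -/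
theorem eventually_mfderiv_comp_mfderiv_symm [IsManifold 𝓘(ℝ, E) 1 S] [IsManifold 𝓘(ℝ, F) 1 M]
    {φ : S → M} (hφ : ContMDiff 𝓘(ℝ, E) 𝓘(ℝ, F) 1 φ) (q : S) :
    ∀ᶠ y in nhds (extChartAt 𝓘(ℝ, E) q q), ∀ v : E,
      (mfderiv 𝓘(ℝ, E) 𝓘(ℝ, F) φ ((extChartAt 𝓘(ℝ, E) q).symm y)
        (mfderiv 𝓘(ℝ, E) 𝓘(ℝ, E) (extChartAt 𝓘(ℝ, E) q).symm y v) : F) =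
      mfderiv 𝓘(ℝ, F) 𝓘(ℝ, F) (extChartAt 𝓘(ℝ, F) (φ q)).symm (localExpression E F φ q y)
        (fderiv ℝ (localExpression E F φ q) y v) := by
  have hΦ := contDiffAt_localExpression (hφ q)
  have heq := comp_localExpression_eventuallyEq (E := E) (F := F) (hφ q).continuousAt (id : M → M)
  filter_upwards [eventually_mem_target_and_mem_source (E := E) (F := F) (hφ q).continuousAt,
    hΦ.eventually (by simp), heq.eventually_nhds] with y ⟨hy, hy'⟩ hΦy heqy v
  have hs : MDifferentiableAt 𝓘(ℝ, E) 𝓘(ℝ, E) (extChartAt 𝓘(ℝ, E) q).symm y :=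
    ((contMDiffOn_extChartAt_symm (n := 1) q).contMDiffAt
      ((isOpen_extChartAt_target q).mem_nhds hy)).mdifferentiableAt (by simp)
  have hz : localExpression E F φ q y ∈ (extChartAt 𝓘(ℝ, F) (φ q)).target :=
    (extChartAt 𝓘(ℝ, F) (φ q)).map_source hy'
  have ht : MDifferentiableAt 𝓘(ℝ, F) 𝓘(ℝ, F) (extChartAt 𝓘(ℝ, F) (φ q)).symm
      (localExpression E F φ q y) :=
    ((contMDiffOn_extChartAt_symm (n := 1) (φ q)).contMDiffAt
      ((isOpen_extChartAt_target (φ q)).mem_nhds hz)).mdifferentiableAt (by simp)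
  have hΦd : MDifferentiableAt 𝓘(ℝ, E) 𝓘(ℝ, F) (localExpression E F φ q) y :=
    (hΦy.differentiableAt (by simp)).mdifferentiableAt
  have hφd : MDifferentiableAt 𝓘(ℝ, E) 𝓘(ℝ, F) φ ((extChartAt 𝓘(ℝ, E) q).symm y) :=
    (hφ _).mdifferentiableAt (by simp)
  have h1 : HasMFDerivAt 𝓘(ℝ, E) 𝓘(ℝ, F) (φ ∘ (extChartAt 𝓘(ℝ, E) q).symm) y _ :=
    hφd.hasMFDerivAt.comp y hs.hasMFDerivAt
  have h2 : HasMFDerivAt 𝓘(ℝ, E) 𝓘(ℝ, F)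
      ((extChartAt 𝓘(ℝ, F) (φ q)).symm ∘ localExpression E F φ q) y _ :=
    ht.hasMFDerivAt.comp y hΦd.hasMFDerivAt
  have h3 := hasMFDerivAt_unique h1 (h2.congr_of_eventuallyEq heqy)
  have h4 := congrArg (fun L : E →L[ℝ] F ↦ L v) h3
  rw [mfderiv_eq_fderiv] at h4
  exact h4

end LocalExpression

/-! ### The Gauss formula and the Hessian of a restriction -/

section Hypersurface

variable {n : ℕ} {M : Type*} [TopologicalSpace M]
  [ChartedSpace (EuclideanSpace ℝ (Fin (n + 1))) M] [IsManifold (𝓡 (n + 1)) ∞ M]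
  {S : Type*} [TopologicalSpace S]
  [ChartedSpace (EuclideanSpace ℝ (Fin n)) S] [IsManifold (𝓡 n) ∞ S]
  {g : LorentzianMetric n M} {φ : S → M}

/-- Near the centre of the chart, the components of `φ^* g` are the pullback of those of `g` by
the local expression of `φ`. -/
theorem eventually_metricInChart_pullbackForm (g : LorentzianMetric n M)
    (hφ : ContMDiff (𝓡 n) (𝓡 (n + 1)) ∞ φ) (q : S) :
    ∀ᶠ y in nhds (extChartAt (𝓡 n) q q), ∀ u v,
      metricInChart (pullbackForm g φ) q y u v =
        metricInChart g.inner (φ q) (localExpression _ _ φ q y)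
          (fderiv ℝ (localExpression _ _ φ q) y u)
          (fderiv ℝ (localExpression _ _ φ q) y v) := by
  have : IsManifold (𝓡 n) 1 S := IsManifold.of_le (n := ∞) (by simp)
  have : IsManifold (𝓡 (n + 1)) 1 M := IsManifold.of_le (n := ∞) (by simp)
  filter_upwards [eventually_mfderiv_comp_mfderiv_symm (hφ.of_le (by simp)) q,
    eventually_mem_target_and_mem_source (E := EuclideanSpace ℝ (Fin n))
      (F := EuclideanSpace ℝ (Fin (n + 1))) (hφ q).continuousAt] with y hy ⟨_, hy'⟩ u v
  have hz : (extChartAt (𝓡 (n + 1)) (φ q)).symm (localExpression _ _ φ q y) =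
      φ ((extChartAt (𝓡 n) q).symm y) := (extChartAt (𝓡 (n + 1)) (φ q)).left_inv hy'
  -- both sides are `g` evaluated at propositionally equal points on the same vectors
  have key : ∀ (z z' : M) (_ : z' = z) (a b a' b' : EuclideanSpace ℝ (Fin (n + 1))),
      a = a' → b = b' → g.inner z a b = g.inner z' a' b' := by
    rintro z _ rfl a b _ _ rfl rfl; rfl
  exact key _ _ hz _ _ _ _ (hy u) (hy v)

/-- Transformation law of the Christoffel symbols of the first kind under pullback. Of the six
terms with a second derivative of `Φ`, four cancel by the symmetry of `g` and of `D²Φ`. -/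
theorem christoffelFirst_pullbackForm (g : LorentzianMetric n M)
    (hφ : ContMDiff (𝓡 n) (𝓡 (n + 1)) ∞ φ) (q : S) (u v w : EuclideanSpace ℝ (Fin n)) :
    let Φ := localExpression (EuclideanSpace ℝ (Fin n)) (EuclideanSpace ℝ (Fin (n + 1))) φ q
    let p := extChartAt (𝓡 n) q q
    christoffelFirst (pullbackForm g φ) q u v w =
      christoffelFirst g.inner (φ q) (fderiv ℝ Φ p u) (fderiv ℝ Φ p v) (fderiv ℝ Φ p w)
        + g.inner (φ q) (fderiv ℝ (fderiv ℝ Φ) p u v) (fderiv ℝ Φ p w) := by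
  intro Φ p
  have : IsManifold (𝓡 (n + 1)) 1 M := IsManifold.of_le (n := ∞) (by simp)
  have hΦ : ContDiffAt ℝ 2 Φ p := contDiffAt_localExpression ((hφ q).of_le ENat.LEInfty.out)
  have hsym : IsSymmSndFDerivAt ℝ Φ p := hΦ.isSymmSndFDerivAt (by simp)
  have hp : Φ p = extChartAt (𝓡 (n + 1)) (φ q) (φ q) := localExpression_self φ q
  have hG := differentiableAt_metricInChart g.contMDiff (φ q)
  rw [← hp] at hG
  let B : EuclideanSpace ℝ (Fin (n + 1)) →L[ℝ] EuclideanSpace ℝ (Fin (n + 1)) →L[ℝ] ℝ :=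
    g.inner (φ q)
  have hBs : ∀ x y, B x y = B y x := g.symm (φ q)
  have hB : ∀ x y, metricInChart g.inner (φ q) (Φ p) x y = B x y := by
    rw [hp]; exact metricInChart_self g.inner (φ q)
  have key := fderiv_bilinearComp_fderiv_apply hΦ hG
    (eventually_metricInChart_pullbackForm g hφ q)
    (differentiableAt_metricInChart (contMDiff_pullbackForm g hφ) q)
  change _ = _ + B _ _
  have hq : extChartAt (𝓡 n) q q = p := rfl
  simp only [christoffelFirst_apply, hq, ← hp, key, hB, hsym.eq v u, hsym.eq w u, hsym.eq w v]
  rw [hBs (fderiv ℝ Φ p v) (fderiv ℝ (fderiv ℝ Φ) p u w),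
    hBs (fderiv ℝ Φ p u) (fderiv ℝ (fderiv ℝ Φ) p v w)]
  ring

/-- Raising and lowering an index cancel, since `g` is nondegenerate; this rules out the junk value
of `ContinuousLinearMap.inverse` in `christoffel`. -/
theorem inner_christoffel (g : LorentzianMetric n M) (x : M)
    (u v w : EuclideanSpace ℝ (Fin (n + 1))) :
    g.inner x (christoffel g.inner x u v) w = christoffelFirst g.inner x u v w := by
  have : IsManifold (𝓡 (n + 1)) 1 M := IsManifold.of_le (n := ∞) (by simp)
  rw [christoffel_apply, ← metricInChart_self, inverse_apply_of_nondegenerate]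
  intro y hy
  simp only [metricInChart_self] at hy
  exact (g.isLorentzian x).eq_zero_of_forall hy

/-- The analogue of `inner_christoffel` for the induced metric, nondegenerate because it is
positive definite. -/
theorem pullbackForm_christoffel (hφ : IsSpacelikeHypersurface g φ) (q : S)
    (u v w : EuclideanSpace ℝ (Fin n)) :
    pullbackForm g φ q (christoffel (pullbackForm g φ) q u v) w =
      christoffelFirst (pullbackForm g φ) q u v w := by
  have : IsManifold (𝓡 n) 1 S := IsManifold.of_le (n := ∞) (by simp)
  rw [christoffel_apply, ← metricInChart_self, inverse_apply_of_nondegenerate]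
  intro y hy
  by_contra h0
  have := hy y
  rw [metricInChart_self] at this
  exact (hφ.pos q y h0).ne' this

/-- The Gauss formula of a totally geodesic hypersurface: `∇_i ∂_j φ` is tangent to the
hypersurface, equal to the image of the Christoffel symbol of the induced metric. The difference of
the two sides is normal; if it were nonzero it could be normalized to a unit normal, to which it
would be orthogonal by `K = 0`. -/
theorem IsTotallyGeodesic.covDerivDifferential_eq (hφ : IsSpacelikeHypersurface g φ)
    (hK : IsTotallyGeodesic g φ) (q : S) (u v : EuclideanSpace ℝ (Fin n)) :
    covDerivDifferential g φ q u v =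
      mfderiv (𝓡 n) (𝓡 (n + 1)) φ q (christoffel (pullbackForm g φ) q u v) := by
  have hφd : MDifferentiableAt (𝓡 n) (𝓡 (n + 1)) φ q :=
    (hφ.contMDiff q).mdifferentiableAt (by simp)
  let A : EuclideanSpace ℝ (Fin n) →L[ℝ] EuclideanSpace ℝ (Fin (n + 1)) :=
    mfderiv (𝓡 n) (𝓡 (n + 1)) φ q
  have hA (v) : fderiv ℝ (localExpression _ _ φ q) (extChartAt (𝓡 n) q q) v = A v :=
    (mfderiv_eq_fderiv_localExpression hφd v).symm
  let B : EuclideanSpace ℝ (Fin (n + 1)) →L[ℝ] EuclideanSpace ℝ (Fin (n + 1)) →L[ℝ] ℝ :=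
    g.inner (φ q)
  have hB : IsLorentzian n B := g.isLorentzian (φ q)
  have hBs : ∀ x y, B x y = B y x := g.symm (φ q)
  let C : EuclideanSpace ℝ (Fin (n + 1)) := covDerivDifferential g φ q u v
  let X : EuclideanSpace ℝ (Fin (n + 1)) := C - A (christoffel (pullbackForm g φ) q u v)
  have hC : C = fderiv ℝ (fderiv ℝ (localExpression _ _ φ q)) (extChartAt (𝓡 n) q q) u v +
      christoffel g.inner (φ q) (A u) (A v) := by
    rw [← hA, ← hA]; rfl
  -- both `∇_i ∂_j φ` and the image of the induced Christoffel symbol pair with `∂_k φ` to `[ij,k]`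
  have hperp (w) : B X (A w) = 0 := by
    have h1 := inner_christoffel g (φ q) (A u) (A v) (A w)
    have h2 := christoffelFirst_pullbackForm g hφ.contMDiff q u v w
    have h3 : B (A (christoffel (pullbackForm g φ) q u v)) (A w) = _ :=
      pullbackForm_christoffel hφ q u v w
    simp only [hA] at h2
    rw [map_sub, hC, map_add, sub_apply, add_apply, h3, h2]
    change B _ _ = _ at h1
    rw [h1]
    change B _ _ + _ - (_ + B _ _) = 0
    ring
  have hX : X = 0 := by
    by_contra hX
    have hneg := hB.neg_of_orthogonal hBs (W := EuclideanSpace ℝ (Fin n)) A (by simp) (hφ.pos q) hX hperp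
    have hr : 0 < Real.sqrt (-B X X) := Real.sqrt_pos.2 (by linarith)
    have hr2 : Real.sqrt (-B X X) ^ 2 = -B X X := Real.sq_sqrt (by linarith)
    have hν : IsUnitNormal g φ q ((Real.sqrt (-B X X))⁻¹ • X : EuclideanSpace ℝ (Fin (n + 1))) := by
      refine ⟨?_, fun (w : EuclideanSpace ℝ (Fin n)) ↦ ?_⟩
      · change B (_ • X) (_ • X) = -1
        simp only [map_smul, smul_apply, smul_eq_mul]
        field_simp
        linarith
      · change B (_ • X) (A w) = 0
        rw [map_smul, smul_apply, hperp, smul_zero]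
    have h1 : -B ((Real.sqrt (-B X X))⁻¹ • X) C = 0 := hK q _ hν u v
    -- `X` differs from `C` by a tangent vector
    have h2 : B X C = B X X := by
      rw [show B X X = B X C - B X (A _) from map_sub (B X) _ _, hperp, sub_zero]
    rw [map_smul, smul_apply, h2, smul_eq_mul, neg_eq_zero] at h1
    exact (mul_ne_zero (inv_ne_zero hr.ne') hneg.ne) h1
  exact sub_eq_zero.1 hX

/-- The Hessian of the restriction of `f` to a totally geodesic hypersurface is the restriction of
the Hessian of `f`. -/
theorem hessian_pullbackForm_comp (hφ : IsSpacelikeHypersurface g φ)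
    (hK : IsTotallyGeodesic g φ) {f : M → ℝ} (hf : ContMDiff (𝓡 (n + 1)) 𝓘(ℝ, ℝ) ∞ f) (q : S)
    (u v : EuclideanSpace ℝ (Fin n)) :
    hessian (pullbackForm g φ) (f ∘ φ) q u v =
      hessian g.inner f (φ q) (mfderiv (𝓡 n) (𝓡 (n + 1)) φ q u)
        (mfderiv (𝓡 n) (𝓡 (n + 1)) φ q v) := by
  have hφd : MDifferentiableAt (𝓡 n) (𝓡 (n + 1)) φ q :=
    (hφ.contMDiff q).mdifferentiableAt (by simp)
  have hΦ : ContDiffAt ℝ 2 (localExpression _ _ φ q) (extChartAt (𝓡 n) q q) :=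
    contDiffAt_localExpression ((hφ.contMDiff q).of_le ENat.LEInfty.out)
  have hF : ContDiffAt ℝ 2 (f ∘ (extChartAt (𝓡 (n + 1)) (φ q)).symm)
      (localExpression _ _ φ q (extChartAt (𝓡 n) q q)) := by
    rw [localExpression_self]
    exact contDiffAt_localExpression ((hf (φ q)).of_le ENat.LEInfty.out)
  have hev := comp_localExpression_eventuallyEq (E := EuclideanSpace ℝ (Fin n))
    (F := EuclideanSpace ℝ (Fin (n + 1))) (hφ.contMDiff q).continuousAt f
  have hcov := hK.covDerivDifferential_eq hφ q u v
  rw [mfderiv_eq_fderiv_localExpression hφd] at hcov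
  change fderiv ℝ (fderiv ℝ (localExpression _ _ φ q)) _ u v +
    christoffel g.inner (φ q) (fderiv ℝ (localExpression _ _ φ q) _ u)
      (fderiv ℝ (localExpression _ _ φ q) _ v) = _ at hcov
  refine (hessian_apply _ _ _ _ _).trans (Eq.trans ?_ (hessian_apply _ _ _ _ _).symm)
  rw [hev.fderiv.fderiv_eq, hev.fderiv_eq,
    fderiv_fderiv_comp_apply hΦ hF,
    fderiv_comp _ (hF.differentiableAt (by simp)) (hΦ.differentiableAt (by simp)),
    mfderiv_eq_fderiv_localExpression hφd, mfderiv_eq_fderiv_localExpression hφd,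
    ContinuousLinearMap.comp_apply, ← hcov, localExpression_self, map_add]
  ring

end Hypersurface

end SpacetimeConvex

open SpacetimeConvex in
theorem proposition3 (n : ℕ)
    (M : Type*) [TopologicalSpace M] [ChartedSpace (EuclideanSpace ℝ (Fin (n + 1))) M]
    [IsManifold (𝓡 (n + 1)) ∞ M]
    (S : Type*) [TopologicalSpace S] [ChartedSpace (EuclideanSpace ℝ (Fin n)) S]
    [IsManifold (𝓡 n) ∞ S]
    (g : LorentzianMetric n M) (f : M → ℝ) (hf : IsSpacetimeConvex g f)
    (φ : S → M) (hφ : IsSpacelikeHypersurface g φ) (hK : IsTotallyGeodesic g φ) :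
    IsUniformlyConvex (inducedMetric g φ hφ) (f ∘ φ) := by
  obtain ⟨c, hc, hbound⟩ := hf.bound
  refine ⟨hf.contMDiff.comp hφ.contMDiff, c, hc, fun q v ↦ ?_⟩
  exact (hbound (φ q) _).trans_eq (hessian_pullbackForm_comp hφ hK hf.contMDiff q v v).symm
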